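/- Let $p$ be a prime, $\mathbb{K}$ a field of characteristic $p$, $R=\mathbb{K}[[x,y,z]]$, $I=(xy,yz)\subseteq R$, $S=R/I$ (a local ring), and let $E_S$ be an injective hull of the residue field of $S$. For an $S$-module $M$ and $e\ge 0$ let $\mathcal{F}^e(M)$ be the group of additive maps $\phi:M\to M$ with $\phi(sm)=s^{p^e}\phi(m)$ for all $s\in S$, $m\in M$, and let $\mathcal{F}(M)=\bigoplus_{e\ge 0}\mathcal{F}^e(M)$ be the ring (in general non-commutative) whose multiplication is given by composition of homogeneous elements; it contains $\mathcal{F}^0(M)=\mathrm{Hom}_S(M,M)$ as a subring. For an ideal $J$ of $R$ let $J^{[q]}$ denote the ideal generated by the $q$-th powers of the elements of $J$, and put, for $e\ge 0$, $K_e=(I^{[p^e]}:I)$ and $$L_e=\sum_{\substack{1\le\beta_1,\dots,\beta_s<e\\ \beta_1+\dots+\beta_s=e}}K_{\beta_1}K_{\beta_2}^{[p^{\beta_1}]}K_{\beta_3}^{[p^{\beta_1+\beta_2}]}\cdots K_{\beta_s}^{[p^{\beta_1+\dots+\beta_{s-1}}]}.$$ Then: 1. the natural map $S\to\mathrm{Hom}_S(E_S,E_S)$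 is an isomorphism; 2. $\mathcal{F}(E_S)$ is not finitely generated as an algebra over $\mathrm{Hom}_S(E_S,E_S)=S$, i.e. there is no finite set $T\subseteq\mathcal{F}(E_S)$ such that $\mathcal{F}(E_S)$ is generated as a ring by $\mathcal{F}^0(E_S)\cup T$; 3. for every $e\ge 1$, $K_e$ is generated by $x^{p^e}y^{p^e-1}$, $x^{p^e-1}y^{p^e-1}z^{p^e-1}$ and $y^{p^e-1}z^{p^e}$, and the generator $x^{p^e}y^{p^e-1}$ does not lie in $L_e$. -/

import Mathlib

open scoped DirectSum

universe u v

namespace FrobeniusMaps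

section FrobeniusAlgebra

/-- `frobeniusMaps p S M e` is the group `𝓕^e(M)` of all additive maps `φ : M → M` such that
`φ (s m) = s ^ (p ^ e) φ m` for all `s ∈ S` and `m ∈ M`. -/
def frobeniusMaps (p : ℕ) (S : Type u) [CommRing S] (M : Type v) [AddCommGroup M] [Module S M]
    (e : ℕ) : AddSubgroup (AddMonoid.End M) where
  carrier := {φ | ∀ (s : S) (m : M), φ (s • m) = s ^ (p ^ e) • φ m}
  zero_mem' := fun s m => (smul_zero (s ^ (p ^ e))).symm
  add_mem' := fun {φ ψ} hφ hψ s m => by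
    have h1 := hφ s m
    have h2 := hψ s m
    change φ (s • m) + ψ (s • m) = s ^ (p ^ e) • (φ m + ψ m)
    rw [h1, h2, smul_add]
  neg_mem' := fun {φ} hφ s m => by
    have h1 := hφ s m
    change -φ (s • m) = s ^ (p ^ e) • -φ m
    rw [h1, smul_neg]

variable (p : ℕ) (S : Type u) [CommRing S] (M : Type v) [AddCommGroup M] [Module S M]

/-- The identity has degree `0`, and degrees add under composition. -/
instance frobeniusMaps_gradedMonoid : SetLike.GradedMonoid (frobeniusMaps p S M) where
  one_mem := fun s m => by simp
  mul_mem := fun i j φ ψ hφ hψ s m => by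
    have h1 : ψ (s • m) = s ^ (p ^ j) • ψ m := hψ s m
    have h2 : φ ((s ^ (p ^ j)) • ψ m) = (s ^ (p ^ j)) ^ (p ^ i) • φ (ψ m) := hφ _ _
    change φ (ψ (s • m)) = s ^ (p ^ (i + j)) • φ (ψ m)
    rw [h1, h2, ← pow_mul, ← pow_add, add_comm]

/-- The algebra of Frobenius maps `𝓕(M) = ⨁_{e ≥ 0} 𝓕^e(M)` (external direct sum). Its ring
structure is the one for which the product of homogeneous elements is their composition. -/
abbrev FrobeniusAlgebra : Type v := ⨁ e, frobeniusMaps p S M e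

/-- The canonical ring homomorphism `Hom_S(M, M) = 𝓕^0(M) → 𝓕(M)`. -/
def ofEnd : Module.End S M →+* FrobeniusAlgebra p S M where
  toFun φ := DirectSum.of (fun e => frobeniusMaps p S M e) 0
    ⟨φ.toAddMonoidHom, fun s m => by
      rw [pow_zero, pow_one]
      exact φ.map_smul s m⟩
  map_one' := rfl
  map_mul' φ ψ := by
    rw [DirectSum.of_mul_of]
    rfl
  map_zero' := by
    rw [← map_zero (DirectSum.of (fun e => frobeniusMaps p S M e) 0)]
    rfl
  map_add' φ ψ := by
    rw [← map_add (DirectSum.of (fun e => frobeniusMaps p S M e) 0)]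
    rfl

end FrobeniusAlgebra

/-- For a homomorphism `f : A → B` of (not necessarily commutative) rings, whose image need not be
central: `B` is finitely generated as an `A`-algebra, i.e. some finite subset of `B` together with
the image of `A` generates `B` as a ring. -/
def FinitelyGeneratedOver {A : Type u} {B : Type v} [Ring A] [Ring B] (f : A →+* B) : Prop :=
  ∃ T : Finset B, Subring.closure (Set.range f ∪ (T : Set B)) = ⊤

/-- `i : M → E` is an injective hull of the `S`-module `M`: `E` is an injective module and `i` is an
essential monomorphism. The modules lie in the universe of `S`, where Mathlib's `Module.Injective`
is injectivity in the usual sense. -/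
structure IsInjectiveHull {S : Type u} [CommRing S] {M E : Type u} [AddCommGroup M] [Module S M]
    [AddCommGroup E] [Module S E] (i : M →ₗ[S] E) : Prop where
  injective_module : Module.Injective S E
  injective_map : Function.Injective i
  essential : ∀ N : Submodule S E, N ⊓ LinearMap.range i = ⊥ → N = ⊥

section Ideals

variable {R : Type u} [CommRing R]

/-- `J^{[q]}`, the ideal generated by the `q`-th powers of the elements of `J`. -/
def frobeniusPower (J : Ideal R) (q : ℕ) : Ideal R :=
  Ideal.span ((fun a => a ^ q) '' (J : Set R))

/-- `K_e = (I^{[p^e]} : I)`. -/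
def idealK (p : ℕ) (I : Ideal R) (e : ℕ) : Ideal R :=
  Submodule.colon (frobeniusPower I (p ^ e)) (I : Set R)

/-- `L_e`, the sum, over all `s` and all `β_1, …, β_s` with `1 ≤ β_j < e` and
`β_1 + ⋯ + β_s = e`, of the ideals
`K_{β_1} K_{β_2}^{[p^{β_1}]} K_{β_3}^{[p^{β_1+β_2}]} ⋯ K_{β_s}^{[p^{β_1+⋯+β_{s-1}}]}`. -/
def idealL (p : ℕ) (I : Ideal R) (e : ℕ) : Ideal R :=
  ⨆ (s : ℕ) (β : Fin s → ℕ) (_ : (∀ j, 1 ≤ β j ∧ β j < e) ∧ ∑ j, β j = e),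
    ∏ j, frobeniusPower (idealK p I (β j)) (p ^ ∑ i ∈ Finset.Iio j, β i)

end Ideals

section Example

variable (K : Type u) [Field K]

/-- `R = K[[x, y, z]]`. -/
abbrev R : Type u := MvPowerSeries (Fin 3) K

/-- The variable `x` of `R`. -/
noncomputable def x : R K := MvPowerSeries.X 0

/-- The variable `y` of `R`. -/
noncomputable def y : R K := MvPowerSeries.X 1

/-- The variable `z` of `R`. -/
noncomputable def z : R K := MvPowerSeries.X 2

/-- `I = (xy, yz)`. -/
noncomputable def I : Ideal (R K) := Ideal.span {x K * y K, y K * z K}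

/-- `S = R / I`. -/
abbrev S : Type u := R K ⧸ I K

instance S_nontrivial : Nontrivial (S K) := by
  refine Ideal.Quotient.nontrivial_iff.mpr fun h => ?_
  have hle : I K ≤ RingHom.ker (MvPowerSeries.constantCoeff (σ := Fin 3) (R := K)) := by
    rw [I, Ideal.span_le]
    rintro a (rfl | rfl) <;> simp [x, y, z, RingHom.mem_ker]
  have h1 := hle (h ▸ Submodule.mem_top : (1 : R K) ∈ I K)
  simp [RingHom.mem_ker] at h1

instance S_isLocalRing : IsLocalRing (S K) :=
  IsLocalRing.of_surjective' (Ideal.Quotient.mk (I K)) Ideal.Quotient.mk_surjective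

end Example

end FrobeniusMaps

/-! An endomorphism of `E` acts on the `𝔪ⁿ`-torsion as multiplication by some `r n`, one step of
`𝔪`-adic precision at a time; by completeness the `r n` converge, and the limit represents it.

The `y`-torsion of `E` is the inverse system of `K[[x, z]]`, with inverse monomials
`w n = x⁻ⁿz⁻ⁿ`, and `w n ↦ w (p ^ t * (n + 1) - 1)` extends to a `p ^ t`-semilinear map on it.
Precomposing with multiplication by `x`, which takes `E` to its `y`-torsion since `xy = 0`, gives a
Frobenius map `φ` on `E` such that `(xz) ^ (p ^ t - 1) • φ (z • w 1)` is the nonzero element `w 0`.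

A composite `φ ∘ ψ` of Frobenius maps of degrees `i, j > 0` cannot do this. If `z` and `x²` kill
`u`, then `(xz) ^ (p ^ j - 1) • ψ u` lies in the socle and so is of the form `y • v`; as `yz = 0`,
applying `φ` and multiplying by a further `z` gives `0`. Hence every degree `t > 0` contains an
indecomposable Frobenius map, and finitely many generators do not suffice.

For the ideals, every term of `L_e` has at least two factors: modulo `z` the last one is divisible
by `x ^ p ^ e` and the first one by a further `x`, whereas `x ^ p ^ e * y ^ (p ^ e - 1)` is not
divisible by `x ^ (p ^ e + 1)` modulo `z`. -/

namespace FrobeniusMaps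

section InjectiveModule

variable {S E : Type u} [CommRing S] [AddCommGroup E] [Module S E]

theorem exists_comp_eq_of_ker_le_ker [Module.Injective S E] {X Y : Type u} [AddCommGroup X]
    [Module S X] [AddCommGroup Y] [Module S Y] (f : X →ₗ[S] Y) (g : X →ₗ[S] E)
    (hfg : LinearMap.ker f ≤ LinearMap.ker g) : ∃ h : Y →ₗ[S] E, h ∘ₗ f = g := by
  have hinj : Function.Injective ((LinearMap.ker f).liftQ f le_rfl) :=
    LinearMap.ker_eq_bot.mp (Submodule.ker_liftQ_eq_bot' _ _ rfl)
  obtain ⟨h, hh⟩ := Module.Injective.out _ hinj ((LinearMap.ker f).liftQ g hfg)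
  exact ⟨h, LinearMap.ext fun v => hh (Submodule.Quotient.mk v)⟩

theorem exists_smul_eq_and_forall_mem_smul_eq_zero [Module.Injective S E] (J : Ideal S) {s : S}
    {v : E} (hv : ∀ t, t * s ∈ J → t • v = 0) :
    ∃ v' : E, s • v' = v ∧ ∀ t ∈ J, t • v' = 0 := by
  obtain ⟨h, hh⟩ := exists_comp_eq_of_ker_le_ker
    (LinearMap.toSpanSingleton S (S ⧸ J) (Ideal.Quotient.mk J s)) (LinearMap.toSpanSingleton S E v)
    fun t ht => hv t (Ideal.Quotient.eq_zero_iff_mem.mp ht)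
  refine ⟨h (Ideal.Quotient.mk J 1), ?_, fun t ht => ?_⟩
  · have := LinearMap.congr_fun hh 1
    simp only [LinearMap.comp_apply, LinearMap.toSpanSingleton_apply, one_smul] at this
    rw [← this, ← map_smul]
    congr 1
    exact congrArg (Ideal.Quotient.mk J) (mul_one s)
  · rw [← map_smul]
    refine (congrArg h ?_).trans (map_zero h)
    exact Ideal.Quotient.eq_zero_iff_mem.mpr (by simpa using ht)

end InjectiveModule

namespace IsInjectiveHull

open IsLocalRing

variable {S E : Type u} [CommRing S] [IsLocalRing S] [AddCommGroup E] [Module S E]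
  {i : ResidueField S →ₗ[S] E}

theorem apply_one_ne_zero (hE : IsInjectiveHull i) : i 1 ≠ 0 :=
  (map_ne_zero_iff i hE.injective_map).mpr one_ne_zero

theorem smul_apply_one_eq_zero_iff (hE : IsInjectiveHull i) {s : S} :
    s • i 1 = 0 ↔ s ∈ maximalIdeal S := by
  rw [← map_smul, map_eq_zero_iff i hE.injective_map, Algebra.smul_def, mul_one,
    ResidueField.algebraMap_eq, residue_eq_zero_iff]

theorem exists_smul_eq_apply_one (hE : IsInjectiveHull i) {e : E} (he : e ≠ 0) :
    ∃ s : S, s • e = i 1 := by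
  have hne : Submodule.span S {e} ⊓ LinearMap.range i ≠ ⊥ := fun h =>
    he (Submodule.span_singleton_eq_bot.mp (hE.essential _ h))
  obtain ⟨_, ⟨hs, k, rfl⟩, hk⟩ := Submodule.exists_mem_ne_zero_of_ne_bot hne
  obtain ⟨s, hs⟩ := Submodule.mem_span_singleton.mp hs
  have hk0 : k ≠ 0 := fun h => hk (h ▸ map_zero i)
  obtain ⟨a, ha⟩ := residue_surjective k⁻¹
  refine ⟨a * s, ?_⟩
  rw [mul_smul, hs, ← map_smul, Algebra.smul_def, ResidueField.algebraMap_eq, ha,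
    inv_mul_cancel₀ hk0]

theorem exists_smul_apply_one_eq (hE : IsInjectiveHull i) {e : E}
    (he : ∀ s ∈ maximalIdeal S, s • e = 0) : ∃ c : S, c • i 1 = e := by
  rcases eq_or_ne e 0 with rfl | hne
  · exact ⟨0, zero_smul _ _⟩
  obtain ⟨s, hs⟩ := hE.exists_smul_eq_apply_one hne
  have hunit : IsUnit s := by
    by_contra h
    exact hE.apply_one_ne_zero (hs ▸ he s h)
  obtain ⟨c, hc⟩ := hunit.exists_left_inv
  exact ⟨c, by rw [← hs, ← mul_smul, hc, one_smul]⟩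

theorem exists_pow_maximalIdeal_smul_eq_zero [IsNoetherianRing S] (hE : IsInjectiveHull i)
    (e : E) : ∃ n : ℕ, ∀ s ∈ maximalIdeal S ^ n, s • e = 0 := by
  by_contra! h
  let N := Submodule.span S {e}
  have hmem : ∀ n, i 1 ∈ (maximalIdeal S ^ n • ⊤ : Submodule S N).map N.subtype := fun n => by
    obtain ⟨s, hs, hse⟩ := h n
    obtain ⟨t, ht⟩ := hE.exists_smul_eq_apply_one hse
    rw [← ht]
    exact Submodule.smul_mem _ t ⟨_, Submodule.smul_mem_smul hs (Submodule.mem_top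
      (x := (⟨e, Submodule.mem_span_singleton_self e⟩ : N))), rfl⟩
  have hbot : i 1 ∈ (⨅ n, maximalIdeal S ^ n • ⊤ : Submodule S N).map N.subtype := by
    rw [Submodule.map_iInf _ N.injective_subtype]
    exact Submodule.mem_iInf _ |>.mpr hmem
  rw [Ideal.iInf_pow_smul_eq_bot_of_isLocalRing _ Ideal.IsPrime.ne_top', Submodule.map_bot] at hbot
  exact hE.apply_one_ne_zero hbot

theorem exists_smul_eq_of_mem_socle (hE : IsInjectiveHull i) {s : S} (hs : s ≠ 0) {v : E}
    (hv : ∀ t ∈ maximalIdeal S, t • v = 0) : ∃ v' : E, s • v' = v := by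
  have := hE.injective_module
  obtain ⟨v', hv', -⟩ := exists_smul_eq_and_forall_mem_smul_eq_zero (⊥ : Ideal S) (s := s)
    fun t ht => hv t <| (mem_maximalIdeal t).mpr fun ht' => hs (ht'.mul_right_eq_zero.mp ht)
  exact ⟨v', hv'⟩

theorem eq_zero_of_forall_smul_eq_zero (hE : IsInjectiveHull i) {s : S}
    (hs : ∀ e : E, s • e = 0) : s = 0 := by
  by_contra hne
  obtain ⟨v, hv⟩ := hE.exists_smul_eq_of_mem_socle hne fun _ => hE.smul_apply_one_eq_zero_iff.mpr
  exact hE.apply_one_ne_zero (hv ▸ hs v)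

theorem exists_smul_eq_apply_of_mem_socle (hE : IsInjectiveHull i) (θ : Module.End S E) :
    ∃ c : S, ∀ e : E, (∀ s ∈ maximalIdeal S, s • e = 0) → θ e = c • e := by
  obtain ⟨c, hc⟩ := hE.exists_smul_apply_one_eq (e := θ (i 1)) fun s hs => by
    rw [← map_smul, hE.smul_apply_one_eq_zero_iff.mpr hs, map_zero]
  refine ⟨c, fun e he => ?_⟩
  obtain ⟨d, rfl⟩ := hE.exists_smul_apply_one_eq he
  rw [map_smul, ← hc, smul_comm]

theorem exists_sub_mem_and_forall_apply_eq_smul [IsNoetherianRing S] (hE : IsInjectiveHull i)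
    (θ : Module.End S E) (n : ℕ) {r : S}
    (hr : ∀ e : E, (∀ s ∈ maximalIdeal S ^ n, s • e = 0) → θ e = r • e) :
    ∃ r' : S, r' - r ∈ maximalIdeal S ^ n ∧
      ∀ e : E, (∀ s ∈ maximalIdeal S ^ (n + 1), s • e = 0) → θ e = r' • e := by
  classical
  have := hE.injective_module
  obtain ⟨T, hT⟩ := (isNoetherianRing_iff_ideal_fg S).mp ‹_› (maximalIdeal S ^ n)
  obtain ⟨h, hh⟩ := exists_comp_eq_of_ker_le_ker
    (LinearMap.pi fun t : T => LinearMap.lsmul S E (t : S)) (θ - r • LinearMap.id) fun e he => by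
      have hann : maximalIdeal S ^ n ≤ LinearMap.ker (LinearMap.toSpanSingleton S E e) := by
        rw [← hT, Ideal.span, Submodule.span_le]
        exact fun t ht => congrFun he ⟨t, ht⟩
      simpa [sub_eq_zero] using hr e hann
  choose c hc using fun t : T => hE.exists_smul_eq_apply_of_mem_socle
    (h ∘ₗ LinearMap.single S (fun _ : T => E) t)
  refine ⟨r + ∑ t : T, c t * t, ?_, fun e he => ?_⟩
  · rw [add_sub_cancel_left]
    exact Ideal.sum_mem _ fun t _ => Ideal.mul_mem_left _ _ (hT ▸ Ideal.subset_span t.2)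
  · have hmem : ∀ t : T, ∀ s ∈ maximalIdeal S, s • (t : S) • e = 0 := fun t s hs => by
      rw [← mul_smul]
      exact he _ (pow_succ' (maximalIdeal S) n ▸
        Ideal.mul_mem_mul hs (hT ▸ Ideal.subset_span t.2))
    have hsum : θ e - r • e = ∑ t : T, c t • (t : S) • e := by
      have hhe : h (fun t : T => (t : S) • e) = θ e - r • e := LinearMap.congr_fun hh e
      rw [← hhe, ← Finset.univ_sum_single fun t : T => (t : S) • e, map_sum]
      exact Finset.sum_congr rfl fun t _ => hc t _ (hmem t)
    rw [add_smul, ← sub_eq_iff_eq_add', hsum, Finset.sum_smul]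
    simp only [mul_smul]

theorem algebraMap_end_bijective [IsNoetherianRing S] [IsPrecomplete (maximalIdeal S) S]
    (hE : IsInjectiveHull i) : Function.Bijective (algebraMap S (Module.End S E)) := by
  refine ⟨(injective_iff_map_eq_zero _).mpr fun s hs =>
    hE.eq_zero_of_forall_smul_eq_zero (LinearMap.congr_fun hs), fun θ => ?_⟩
  choose! next hsub hnext using fun n (r : S) => hE.exists_sub_mem_and_forall_apply_eq_smul θ n
    (r := r)
  let r : ℕ → S := fun n => Nat.rec 0 next n
  have hr : ∀ n, ∀ e : E, (∀ s ∈ maximalIdeal S ^ n, s • e = 0) → θ e = r n • e := fun n => by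
    induction n with
    | zero => exact fun e he => by simp [show e = 0 by simpa using he 1 (by simp)]
    | succ n ih => exact hnext n (r n) ih
  obtain ⟨s, hs⟩ := IsPrecomplete.prec ‹IsPrecomplete (maximalIdeal S) S›
    ((AdicCompletion.isAdicCauchy_iff _ _ r).mpr fun n => SModEq.symm <| SModEq.sub_mem.mpr <| by
      simpa using hsub n (r n) (hr n))
  refine ⟨s, LinearMap.ext fun e => ?_⟩
  obtain ⟨n, hn⟩ := hE.exists_pow_maximalIdeal_smul_eq_zero e
  have hsn := hn _ (by simpa using SModEq.sub_mem.mp (hs n))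
  rw [hr n e hn, Module.algebraMap_end_apply]
  exact (sub_eq_zero.mp (by rwa [sub_smul] at hsn)).symm

theorem exists_smul_eq_of_forall_smul_eq_zero [IsNoetherianRing S]
    [IsPrecomplete (maximalIdeal S) S] (hE : IsInjectiveHull i) {v e : E}
    (h : ∀ s : S, s • v = 0 → s • e = 0) : ∃ s : S, s • v = e := by
  have := hE.injective_module
  obtain ⟨θ, hθ⟩ := exists_comp_eq_of_ker_le_ker (LinearMap.toSpanSingleton S E v)
    (LinearMap.toSpanSingleton S E e) h
  obtain ⟨s, rfl⟩ := hE.algebraMap_end_bijective.surjective θ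
  exact ⟨s, by simpa using LinearMap.congr_fun hθ 1⟩

end IsInjectiveHull

section MonomialIdeals

open MvPowerSeries

variable {σ A : Type*} [CommRing A]

theorem exists_le_of_mem_span_monomial {G : Set (σ →₀ ℕ)} {f : MvPowerSeries σ A}
    (hf : f ∈ Ideal.span ((monomial · (1 : A)) '' G)) {d : σ →₀ ℕ} (hd : coeff d f ≠ 0) :
    ∃ g ∈ G, g ≤ d := by
  classical
  induction hf using Submodule.span_induction generalizing d with
  | mem a ha =>
    obtain ⟨g, hg, rfl⟩ := ha
    exact ⟨g, hg, (eq_of_coeff_monomial_ne_zero hd).ge⟩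
  | zero => exact absurd (map_zero _) hd
  | add a b _ _ iha ihb =>
    by_cases ha : coeff d a = 0
    · exact ihb (by rwa [map_add, ha, zero_add] at hd)
    · exact iha ha
  | smul r a _ iha =>
    rw [smul_eq_mul, coeff_mul] at hd
    obtain ⟨⟨m, n⟩, hmn, h⟩ := Finset.exists_ne_zero_of_sum_ne_zero hd
    obtain ⟨g, hg, hgn⟩ := iha (right_ne_zero_of_mul h)
    exact ⟨g, hg, hgn.trans (Finset.HasAntidiagonal.mem_antidiagonal.mp hmn ▸ le_add_self)⟩

theorem exists_le_add_of_monomial_mul_mem_span {G : Set (σ →₀ ℕ)} {f : MvPowerSeries σ A}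
    {m d : σ →₀ ℕ} (hf : monomial m 1 * f ∈ Ideal.span ((monomial · (1 : A)) '' G))
    (hd : coeff d f ≠ 0) : ∃ g ∈ G, g ≤ m + d :=
  exists_le_of_mem_span_monomial hf (by rwa [coeff_add_monomial_mul, one_mul])

theorem mem_span_monomial_of_forall_exists_le {G : Finset (σ →₀ ℕ)} {f : MvPowerSeries σ A}
    (hf : ∀ d, coeff d f ≠ 0 → ∃ g ∈ G, g ≤ d) :
    f ∈ Ideal.span ((monomial · (1 : A)) '' (G : Set (σ →₀ ℕ))) := by
  classical
  choose! γ hγG hγle using hf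
  -- `γ` assigns each term of `f` to one generator `g`; collecting the terms assigned to `g` and
  -- dividing them by the monomial `g` gives the cofactor `r g`.
  let r : (σ →₀ ℕ) → MvPowerSeries σ A := fun g m =>
    if γ (m + g) = g then coeff (m + g) f else 0
  have hr (g m) : coeff m (r g) = if γ (m + g) = g then coeff (m + g) f else 0 := rfl
  have hterm (g d) : coeff d (r g * monomial g 1) = if γ d = g ∧ g ≤ d then coeff d f else 0 := by
    rw [coeff_mul_monomial, mul_one, hr]
    by_cases hgd : g ≤ d <;> simp [hgd, tsub_add_cancel_of_le]
  have hsum : f = ∑ g ∈ G, r g * monomial g 1 := by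
    ext d
    simp only [map_sum, hterm]
    by_cases hd : coeff d f = 0
    · simp [hd]
    · rw [Finset.sum_eq_single_of_mem (γ d) (hγG d hd) fun g _ hg => if_neg fun h => hg h.1.symm,
        if_pos ⟨rfl, hγle d hd⟩]
  rw [hsum]
  exact Ideal.sum_mem _ fun g hg => Ideal.mul_mem_left _ _ (Ideal.subset_span ⟨g, hg, rfl⟩)

theorem mem_span_monomial_iff {G : Finset (σ →₀ ℕ)} {f : MvPowerSeries σ A} :
    f ∈ Ideal.span ((monomial · (1 : A)) '' (G : Set (σ →₀ ℕ))) ↔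
      ∀ d, coeff d f ≠ 0 → ∃ g ∈ G, g ≤ d :=
  ⟨fun hf _ hd => exists_le_of_mem_span_monomial hf hd, mem_span_monomial_of_forall_exists_le⟩

variable [Finite σ]

theorem mem_span_X_pow_iff (d : σ →₀ ℕ) {f : MvPowerSeries σ A} :
    f ∈ Ideal.span (Set.range fun s => (X s : MvPowerSeries σ A) ^ (d s + 1)) ↔
      ∀ m ≤ d, coeff m f = 0 := by
  classical
  have := Fintype.ofFinite σ
  have hset : (Set.range fun s => (X s : MvPowerSeries σ A) ^ (d s + 1)) =
      (monomial · (1 : A)) ''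
        (Finset.univ.image fun s => Finsupp.single s (d s + 1) : Finset (σ →₀ ℕ)) := by
    simp only [X_pow_eq, Finset.coe_image, Finset.coe_univ, Set.image_univ, ← Set.range_comp]
    rfl
  rw [hset, mem_span_monomial_iff]
  refine forall_congr' fun m => ?_
  have hle : m ≤ d ↔ ¬∃ s, d s + 1 ≤ m s := by simp [Finsupp.le_def]
  simp only [Finset.mem_image, Finset.mem_univ, true_and, exists_exists_eq_and,
    Finsupp.single_le_iff, hle, ne_eq]
  tauto

theorem monomial_notMem_span_X_pow [Nontrivial A] (d : σ →₀ ℕ) :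
    monomial d (1 : A) ∉ Ideal.span (Set.range fun s => (X s : MvPowerSeries σ A) ^ (d s + 1)) := by
  classical
  exact fun h => one_ne_zero ((coeff_monomial_same d (1 : A)).symm.trans
    ((mem_span_X_pow_iff d).mp h d le_rfl))

theorem exists_mul_sub_monomial_mem_span_X_pow {k : Type*} [Field k] (d : σ →₀ ℕ)
    {f : MvPowerSeries σ k}
    (hf : f ∉ Ideal.span (Set.range fun s => (X s : MvPowerSeries σ k) ^ (d s + 1))) :
    ∃ g, g * f - monomial d 1 ∈
      Ideal.span (Set.range fun s => (X s : MvPowerSeries σ k) ^ (d s + 1)) := by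
  classical
  rw [mem_span_X_pow_iff] at hf
  push Not at hf
  obtain ⟨m, ⟨hmd, hm⟩, hmin⟩ := wellFounded_lt.has_min {m | m ≤ d ∧ coeff m f ≠ 0} hf
  refine ⟨monomial (d - m) (coeff m f)⁻¹, (mem_span_X_pow_iff d).mpr fun n hnd => ?_⟩
  rw [map_sub, coeff_monomial_mul, coeff_monomial, sub_eq_zero]
  split_ifs with hle heq heq
  · rw [heq, tsub_tsub_cancel_of_le hmd, inv_mul_cancel₀ hm]
  · have hlt : n - (d - m) < m := by
      refine (tsub_le_iff_left.mpr (hnd.trans le_tsub_add)).lt_of_ne fun h => heq ?_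
      rw [← tsub_add_cancel_of_le hle, h, add_tsub_cancel_of_le hmd]
    rw [not_not.mp fun h => hmin _ ⟨hlt.le.trans hmd, h⟩ hlt, mul_zero]
  · exact absurd (heq ▸ tsub_le_self) hle
  · rfl

end MonomialIdeals

section Complete

open IsLocalRing

theorem maximalIdeal_eq_span_range_X (σ k : Type*) [Finite σ] [Field k] :
    maximalIdeal (MvPowerSeries σ k) = Ideal.span (Set.range MvPowerSeries.X) := by
  have h (f : MvPowerSeries σ k) :
      f ∈ Ideal.span (Set.range MvPowerSeries.X) ↔ MvPowerSeries.constantCoeff f = 0 := by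
    simpa using mem_span_X_pow_iff (0 : σ →₀ ℕ) (f := f)
  ext f
  rw [h, mem_maximalIdeal, mem_nonunits_iff, MvPowerSeries.isUnit_iff_constantCoeff,
    isUnit_iff_ne_zero, not_not]

theorem isPrecomplete_of_surjective {A M N : Type*} [CommRing A] [AddCommGroup M] [Module A M]
    [AddCommGroup N] [Module A N] (J : Ideal A) [IsPrecomplete J M] {f : M →ₗ[A] N}
    (hf : Function.Surjective f) : IsPrecomplete J N := by
  rw [← AdicCompletion.of_surjective_iff]
  intro b
  obtain ⟨a, rfl⟩ := AdicCompletion.map_surjective J hf b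
  obtain ⟨m, rfl⟩ := AdicCompletion.of_surjective J M a
  exact ⟨f m, (AdicCompletion.map_of J f m).symm⟩

theorem isPrecomplete_maximalIdeal_quotient {A : Type*} [CommRing A] [IsLocalRing A]
    [IsPrecomplete (maximalIdeal A) A] (J : Ideal A) [IsLocalRing (A ⧸ J)] :
    IsPrecomplete (maximalIdeal (A ⧸ J)) (A ⧸ J) := by
  have := isPrecomplete_of_surjective (maximalIdeal A) (f := J.mkQ) J.mkQ_surjective
  rw [← map_maximalIdeal_of_surjective (algebraMap A (A ⧸ J)) Ideal.Quotient.mk_surjective]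
  exact IsPrecomplete.map_algebraMap_iff.mpr this

end Complete

theorem pow_sub_smul_eq_of_smul_succ_eq {A M : Type*} [CommRing A] [AddCommGroup M] [Module A M]
    {s : A} {w : ℕ → M} (hw : ∀ n, s • w (n + 1) = w n) {m n : ℕ} (hmn : m ≤ n) :
    s ^ (n - m) • w n = w m := by
  induction n, hmn using Nat.le_induction with
  | base => rw [Nat.sub_self, pow_zero, one_smul]
  | succ n hmn ih => rw [Nat.succ_sub hmn, pow_succ, mul_smul, hw, ih]

section InverseMonomialSequence

variable {S E : Type u} [CommRing S] [AddCommGroup E] [Module S E]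

theorem exists_smul_succ_eq_and_smul_eq_zero_iff [Module.Injective S E] {s : S} {J : ℕ → Ideal S}
    (hmul : ∀ n, ∀ a ∈ J n, s * a ∈ J (n + 1)) (hpow : ∀ n, s ^ n ∉ J n)
    (hsocle : ∀ n, ∀ a ∉ J n, ∃ b, b * a - s ^ n ∈ J n) {v : E} (hv : v ≠ 0)
    (hJv : ∀ a ∈ J 0, a • v = 0) :
    ∃ w : ℕ → E, w 0 = v ∧ (∀ n, s • w (n + 1) = w n) ∧
      ∀ n (a : S), a • w n = 0 ↔ a ∈ J n := by
  have hcancel (n a) (ha : a * s ∈ J (n + 1)) : a ∈ J n := by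
    by_contra h
    obtain ⟨b, hb⟩ := hsocle n a h
    refine hpow (n + 1) ?_
    convert sub_mem (Ideal.mul_mem_left _ b ha) (hmul n _ hb) using 1
    ring
  have hdiv (n : ℕ) (u : E) (hu : ∀ a ∈ J n, a • u = 0) :
      ∃ u' : E, s • u' = u ∧ ∀ a ∈ J (n + 1), a • u' = 0 :=
    exists_smul_eq_and_forall_mem_smul_eq_zero _ fun a ha => hu a (hcancel n a ha)
  choose! next hnext hnextJ using hdiv
  let w : ℕ → E := fun n => Nat.rec v next n
  have hJ (n) : ∀ a ∈ J n, a • w n = 0 := by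
    induction n with
    | zero => exact hJv
    | succ n ih => exact hnextJ n _ ih
  have hsucc (n) : s • w (n + 1) = w n := hnext n _ (hJ n)
  have hpow_smul (n) : s ^ n • w n = v := pow_sub_smul_eq_of_smul_succ_eq hsucc n.zero_le
  refine ⟨w, rfl, hsucc, fun n a => ⟨fun ha => ?_, hJ n a⟩⟩
  by_contra h
  obtain ⟨b, hb⟩ := hsocle n a h
  refine hv ?_
  rw [← hpow_smul n, ← sub_eq_zero.mp ((sub_smul _ _ _).symm.trans (hJ n _ hb)), mul_smul, ha,
    smul_zero]

/-- `w n` behaves like the inverse monomial `x⁻ⁿz⁻ⁿ` of the inverse system of `S ⧸ (y)`: the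
sequence is a tower under multiplication by `xz`, the annihilators are `(xⁿ⁺¹, y, zⁿ⁺¹)`, and its
terms exhaust the `y`-torsion of `E`. -/
structure IsInverseMonomialSequence (x y z : S) (w : ℕ → E) : Prop where
  ne_zero : w 0 ≠ 0
  smul_succ : ∀ n, (x * z) • w (n + 1) = w n
  smul_eq_zero_iff : ∀ n (a : S), a • w n = 0 ↔ a ∈ Ideal.span {x ^ (n + 1), y, z ^ (n + 1)}
  exists_smul_eq : ∀ e, y • e = 0 → ∃ n, ∃ a : S, a • w n = e

open IsLocalRing in
theorem IsInjectiveHull.exists_isInverseMonomialSequence [IsLocalRing S] [IsNoetherianRing S]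
    [IsPrecomplete (maximalIdeal S) S] {i : ResidueField S →ₗ[S] E} (hE : IsInjectiveHull i)
    {x y z : S} (hx : x ∈ maximalIdeal S) (hy : y ∈ maximalIdeal S) (hz : z ∈ maximalIdeal S)
    (hpow : ∀ n, (x * z) ^ n ∉ Ideal.span {x ^ (n + 1), y, z ^ (n + 1)})
    (hsocle : ∀ n, ∀ a ∉ Ideal.span {x ^ (n + 1), y, z ^ (n + 1)},
      ∃ b, b * a - (x * z) ^ n ∈ Ideal.span {x ^ (n + 1), y, z ^ (n + 1)}) :
    ∃ w : ℕ → E, IsInverseMonomialSequence x y z w := by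
  have := hE.injective_module
  have hmul (n a) (ha : a ∈ Ideal.span {x ^ (n + 1), y, z ^ (n + 1)}) :
      x * z * a ∈ Ideal.span {x ^ (n + 1 + 1), y, z ^ (n + 1 + 1)} := by
    obtain ⟨b, c, d, rfl⟩ := Submodule.mem_span_triple.mp ha
    exact Submodule.mem_span_triple.mpr ⟨b * z, x * z * c, d * x, by ring⟩
  obtain ⟨w, hw0, hsucc, hann⟩ := exists_smul_succ_eq_and_smul_eq_zero_iff hmul hpow hsocle
    hE.apply_one_ne_zero fun a ha => hE.smul_apply_one_eq_zero_iff.mpr <| by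
      refine Ideal.span_le.mpr ?_ ha
      simp [Set.insert_subset_iff, hx, hy, hz]
  refine ⟨w, hw0 ▸ hE.apply_one_ne_zero, hsucc, hann, fun e he => ?_⟩
  obtain ⟨n, hn⟩ := hE.exists_pow_maximalIdeal_smul_eq_zero e
  refine ⟨n, hE.exists_smul_eq_of_forall_smul_eq_zero fun a ha => ?_⟩
  obtain ⟨b, c, d, rfl⟩ := Submodule.mem_span_triple.mp ((hann n a).mp ha)
  have hxn := hn _ (Ideal.pow_le_pow_right n.le_succ (Ideal.pow_mem_pow hx (n + 1)))
  have hzn := hn _ (Ideal.pow_le_pow_right n.le_succ (Ideal.pow_mem_pow hz (n + 1)))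
  simp only [add_smul, smul_assoc, hxn, hzn, he, smul_zero, add_zero]

end InverseMonomialSequence

section SemilinearExtension

variable {A B M N : Type*} [CommRing A] [CommRing B] [AddCommGroup M] [Module A M]
  [AddCommGroup N] [Module B N]

theorem exists_semilinearMap_apply_eq (σ : A →+* B) {s : A} {w : ℕ → M} {v : ℕ → N}
    (hw : ∀ n, s • w (n + 1) = w n) (hv : ∀ n, σ s • v (n + 1) = v n)
    (hwv : ∀ n (a : A), a • w n = 0 → σ a • v n = 0) (hspan : ∀ m, ∃ n, ∃ a : A, a • w n = m) :
    ∃ F : M →ₛₗ[σ] N, ∀ n, F (w n) = v n := by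
  have hraise {m n : ℕ} (h : m ≤ n) (a : A) : (a * s ^ (n - m)) • w n = a • w m ∧
      σ (a * s ^ (n - m)) • v n = σ a • v m := by
    rw [mul_smul, pow_sub_smul_eq_of_smul_succ_eq hw h, map_mul, mul_smul, map_pow,
      pow_sub_smul_eq_of_smul_succ_eq hv h]
    exact ⟨rfl, rfl⟩
  have hsame (n a b) (h : a • w n = b • w n) : σ a • v n = σ b • v n := by
    rw [← sub_eq_zero, ← sub_smul, ← map_sub]
    exact hwv n _ (by rw [sub_smul, h, sub_self])
  have hwell (m n a b) (h : a • w m = b • w n) : σ a • v m = σ b • v n := by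
    rw [← (hraise (le_max_left m n) a).2, ← (hraise (le_max_right m n) b).2]
    exact hsame _ _ _ (by
      rw [(hraise (le_max_left m n) a).1, (hraise (le_max_right m n) b).1, h])
  choose level coeff hrepr using hspan
  let F (m : M) : N := σ (coeff m) • v (level m)
  have hF (n a) : F (a • w n) = σ a • v n := hwell _ _ _ _ (hrepr _)
  refine ⟨⟨⟨F, fun m m' => ?_⟩, fun a m => ?_⟩, fun n => by simpa using hF n 1⟩
  · have h := le_max_left (level m) (level m')
    have h' := le_max_right (level m) (level m')
    rw [← hrepr m, ← hrepr m', ← (hraise h _).1, ← (hraise h' _).1, ← add_smul]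
    rw [hF, hF, hF, map_add, add_smul]
  · change F (a • m) = σ a • F m
    rw [← hrepr m, ← mul_smul, hF, hF, map_mul, mul_smul]

end SemilinearExtension

section DecomposableElements

open DirectSum

variable {Q : Type v} [Ring Q] (𝒜 : ℕ → AddSubgroup Q) (V : ℕ → AddSubgroup Q)

/-- The groups `V t` are stable under multiplication by elements of degree `0` and contain every
product of two elements of positive degree, so that an element of `𝒜 t` outside `V t` is
indecomposable. -/
structure ContainsDecomposables : Prop where
  mul_mem_of_degree_zero_left : ∀ {t a b}, a ∈ 𝒜 0 → b ∈ V t → a * b ∈ V t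
  mul_mem_of_degree_zero_right : ∀ {t a b}, a ∈ V t → b ∈ 𝒜 0 → a * b ∈ V t
  mul_mem : ∀ {s t a b}, 0 < s → 0 < t → a ∈ 𝒜 s → b ∈ 𝒜 t → a * b ∈ V (s + t)

variable {𝒜 V} [SetLike.GradedMonoid 𝒜]

/-- The elements of `⨁ t, 𝒜 t` whose components of degree greater than `N` lie in `V`. A finite
set is contained in this subring once `N` bounds the degrees occurring in it. -/
def ContainsDecomposables.tailSubring (hV : ContainsDecomposables 𝒜 V) (N : ℕ) :
    Subring (⨁ t, 𝒜 t) where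
  carrier := {f | ∀ t, N < t → (f t : Q) ∈ V t}
  zero_mem' t _ := zero_mem (V t)
  one_mem' t ht := by
    have hone : (1 : ⨁ t, 𝒜 t) t = 0 := of_eq_of_ne (β := (𝒜 ·)) 0 t _ (by omega)
    rw [hone]
    exact zero_mem (V t)
  add_mem' hf hg t ht := add_mem (hf t ht) (hg t ht)
  neg_mem' hf t ht := neg_mem (hf t ht)
  mul_mem' {f g} hf hg t ht := by
    classical
    rw [coe_mul_apply]
    refine sum_mem fun ⟨i, j⟩ hij => ?_
    obtain rfl : i + j = t := (Finset.mem_filter.mp hij).2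
    rcases Nat.eq_zero_or_pos i with rfl | hi
    · rw [zero_add] at ht ⊢
      exact hV.mul_mem_of_degree_zero_left (f 0).2 (hg j ht)
    rcases Nat.eq_zero_or_pos j with rfl | hj
    · exact hV.mul_mem_of_degree_zero_right (hf i ht) (g 0).2
    · exact hV.mul_mem hi hj (f i).2 (g j).2

theorem ContainsDecomposables.not_finitelyGeneratedOver (hV : ContainsDecomposables 𝒜 V)
    {A : Type u} [Ring A] {f : A →+* ⨁ t, 𝒜 t} (hf : ∀ a t, 0 < t → f a t = 0)
    (hex : ∀ N, ∃ t, N < t ∧ ∃ a ∈ 𝒜 t, a ∉ V t) : ¬ FinitelyGeneratedOver f := by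
  classical
  rintro ⟨T, hT⟩
  let N := T.sup fun g => g.support.sup id
  have htop : hV.tailSubring N = ⊤ := by
    rw [eq_top_iff, ← hT, Subring.closure_le]
    rintro g (⟨a, rfl⟩ | hg) t ht
    · rw [hf a t (by omega)]
      exact zero_mem (V t)
    · have hzero : g t = 0 := by
        by_contra hne
        have htg : t ≤ g.support.sup id :=
          Finset.le_sup (f := id) (DFinsupp.mem_support_iff.mpr hne)
        exact ht.not_ge (htg.trans (Finset.le_sup (f := fun g => g.support.sup id) hg))
      rw [hzero]
      exact zero_mem (V t)
  obtain ⟨t, ht, a, ha, haV⟩ := hex N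
  have hmem : of (𝒜 ·) t ⟨a, ha⟩ ∈ hV.tailSubring N := htop ▸ Subring.mem_top _
  have := hmem t ht
  rw [of_eq_same] at this
  exact haV this

end DecomposableElements

section SocleVanishing

variable {S : Type u} {E : Type v} [CommRing S] [AddCommGroup E] [Module S E] {x y z : S} {p : ℕ}

variable (E) in
/-- The maps `φ` with `(xz)^(p^t - 1) φ(u) = 0` for all `u` killed by `z` and `x²`. When `xy`, `yz`
vanish and `E` is the injective hull, decomposable Frobenius maps of degree `t` have this
property. -/
def socleVanishing (p : ℕ) (x z : S) (t : ℕ) : AddSubgroup (AddMonoid.End E) where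
  carrier := {φ | ∀ u : E, z • u = 0 → x • x • u = 0 → (x * z) ^ (p ^ t - 1) • φ u = 0}
  zero_mem' _ _ _ := smul_zero _
  add_mem' {φ ψ} hφ hψ u hz hx := by
    change _ • (φ u + ψ u) = 0
    rw [smul_add, hφ u hz hx, hψ u hz hx, add_zero]
  neg_mem' {φ} hφ u hz hx := (smul_neg _ (φ u)).trans (by rw [hφ u hz hx, neg_zero])

theorem apply_smul_of_mem_frobeniusMaps {t : ℕ} {φ : AddMonoid.End E}
    (hφ : φ ∈ frobeniusMaps p S E t) (s : S) (u : E) : φ (s • u) = s ^ p ^ t • φ u :=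
  hφ s u

theorem smul_apply_smul_eq_zero {s s' : S} (h : s * s' = 0) {t : ℕ} (hp : p ≠ 0)
    {φ : AddMonoid.End E} (hφ : φ ∈ frobeniusMaps p S E t) (u : E) : s • φ (s' • u) = 0 := by
  have hzero : s * s' ^ p ^ t = 0 := by
    rw [← mul_pow_sub_one (pow_ne_zero t hp), ← mul_assoc, h, zero_mul]
  rw [apply_smul_of_mem_frobeniusMaps hφ, ← mul_smul, hzero, zero_smul]

theorem smul_pow_smul_apply_eq_zero (hxy : x * y = 0) (hyz : y * z = 0) (hp : 1 < p)
    (hdiv : ∀ v : E, x • v = 0 → y • v = 0 → z • v = 0 → ∃ v', y • v' = v) {t : ℕ} (ht : 0 < t)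
    {ψ : AddMonoid.End E} (hψ : ψ ∈ frobeniusMaps p S E t) {u : E} (hzu : z • u = 0)
    (hxu : x • x • u = 0) :
    x • (x * z) ^ (p ^ t - 1) • ψ u = 0 ∧ y • (x * z) ^ (p ^ t - 1) • ψ u = 0 ∧
      z • (x * z) ^ (p ^ t - 1) • ψ u = 0 := by
  obtain ⟨k, hk⟩ := Nat.exists_eq_add_of_le' (m := 2) (Nat.one_lt_pow ht.ne' hp)
  have hψz : z ^ p ^ t • ψ u = 0 := by
    rw [← apply_smul_of_mem_frobeniusMaps hψ, hzu, map_zero]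
  -- `xu` lies in the socle, hence is a multiple of `y`, so that `z` kills `ψ(xu)`
  have hψx : z • x ^ p ^ t • ψ u = 0 := by
    obtain ⟨u', hu'⟩ := hdiv (x • u) hxu (by rw [← mul_smul, mul_comm, hxy, zero_smul])
      (by rw [smul_comm, hzu, smul_zero])
    rw [← apply_smul_of_mem_frobeniusMaps hψ, ← hu']
    exact smul_apply_smul_eq_zero ((mul_comm z y).trans hyz) (by omega) hψ u'
  rw [hk] at hψz hψx ⊢
  rw [show k + 2 - 1 = k + 1 from rfl]
  refine ⟨?_, ?_, ?_⟩
  · rw [← mul_smul, show x * (x * z) ^ (k + 1) = z ^ k * (z * x ^ (k + 2)) by ring, mul_smul,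
      mul_smul, hψx, smul_zero]
  · rw [← mul_smul, show y * (x * z) ^ (k + 1) = (x * y) * (z * (x * z) ^ k) by ring, hxy,
      zero_mul, zero_smul]
  · rw [← mul_smul, show z * (x * z) ^ (k + 1) = x ^ (k + 1) * z ^ (k + 2) by ring, mul_smul,
      hψz, smul_zero]

theorem containsDecomposables_socleVanishing (hxy : x * y = 0) (hyz : y * z = 0) (hp : 1 < p)
    (hdiv : ∀ v : E, x • v = 0 → y • v = 0 → z • v = 0 → ∃ v', y • v' = v) :
    ContainsDecomposables (frobeniusMaps p S E) (socleVanishing E p x z) where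
  mul_mem_of_degree_zero_left {t φ ψ} hφ hψ u hz hx := by
    have hlinear := apply_smul_of_mem_frobeniusMaps hφ ((x * z) ^ (p ^ t - 1)) (ψ u)
    rw [pow_zero, pow_one] at hlinear
    change _ • φ (ψ u) = 0
    rw [← hlinear, hψ u hz hx, map_zero]
  mul_mem_of_degree_zero_right {t φ ψ} hφ hψ u hz hx := by
    have hlinear (s : S) (v : E) : ψ (s • v) = s • ψ v := by
      rw [apply_smul_of_mem_frobeniusMaps hψ, pow_zero, pow_one]
    exact hφ (ψ u) (by rw [← hlinear, hz, map_zero]) (by rw [← hlinear, ← hlinear, hx, map_zero])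
  mul_mem {i j φ ψ} hi hj hφ hψ u hz hx := by
    obtain ⟨hxv, hyv, hzv⟩ := smul_pow_smul_apply_eq_zero hxy hyz hp hdiv hj hψ hz hx
    obtain ⟨v, hv⟩ := hdiv _ hxv hyv hzv
    obtain ⟨k, hk⟩ := Nat.exists_eq_add_of_le' (m := 2) (Nat.one_lt_pow hi.ne' hp)
    obtain ⟨l, hl⟩ := Nat.exists_eq_add_of_le' (m := 2) (Nat.one_lt_pow hj.ne' hp)
    have hexp : (x * z) ^ (p ^ (i + j) - 1) =
        (x * z) ^ k * x * z * ((x * z) ^ (p ^ j - 1)) ^ p ^ i := by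
      rw [← pow_mul, mul_assoc _ x z, ← pow_succ, ← pow_add, pow_add p, hk, hl]
      congr 1
      rw [Nat.sub_eq_iff_eq_add (Nat.succ_le_of_lt (by positivity)),
        show l + 2 - 1 = l + 1 from rfl]
      ring
    change _ • φ (ψ u) = 0
    rw [hexp, mul_smul, ← apply_smul_of_mem_frobeniusMaps hφ, ← hv,
      mul_smul, smul_apply_smul_eq_zero ((mul_comm z y).trans hyz) (by omega) hφ, smul_zero]

end SocleVanishing

section IndecomposableMaps

variable {S E : Type u} [CommRing S] [AddCommGroup E] [Module S E] {x y z : S} {w : ℕ → E}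
  {p : ℕ} [ExpChar S p]

namespace IsInverseMonomialSequence

theorem smul_eq_zero (hw : IsInverseMonomialSequence x y z w) (n : ℕ) : y • w n = 0 :=
  (hw.smul_eq_zero_iff n y).mpr (Ideal.subset_span (by simp))

theorem pow_sub_smul (hw : IsInverseMonomialSequence x y z w) {m n : ℕ} (hmn : m ≤ n) :
    (x * z) ^ (n - m) • w n = w m :=
  pow_sub_smul_eq_of_smul_succ_eq hw.smul_succ hmn

theorem exists_semilinearMap_apply (hw : IsInverseMonomialSequence x y z w) (t : ℕ) :
    ∃ F : Submodule.torsionBy S E y →ₛₗ[iterateFrobenius S p t] E,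
      ∀ n, F ⟨w n, hw.smul_eq_zero n⟩ = w (p ^ t * (n + 1) - 1) := by
  have hp : 0 < p ^ t := pow_pos (expChar_pos S p) t
  let w' (n : ℕ) : Submodule.torsionBy S E y := ⟨w n, hw.smul_eq_zero n⟩
  refine exists_semilinearMap_apply_eq _ (w := w') (s := x * z)
    (v := fun n => w (p ^ t * (n + 1) - 1)) (fun n => Subtype.ext (hw.smul_succ n))
    (fun n => ?_) (fun n a ha => ?_) fun ⟨e, he⟩ => ?_
  · have hlevel : p ^ t * (n + 1 + 1) - 1 = p ^ t * (n + 1) - 1 + p ^ t := by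
      have : 0 < p ^ t * (n + 1) := Nat.mul_pos hp n.succ_pos
      rw [mul_add_one _ (n + 1)]
      omega
    simpa [iterateFrobenius_def, hlevel] using hw.pow_sub_smul (Nat.le_add_right _ (p ^ t))
  · rw [hw.smul_eq_zero_iff, Nat.sub_add_cancel (Nat.mul_pos hp n.succ_pos), ← Ideal.mem_comap]
    refine Ideal.span_le.mpr ?_ ((hw.smul_eq_zero_iff n a).mp (congrArg Subtype.val ha))
    rintro _ (rfl | rfl | rfl) <;> rw [SetLike.mem_coe, Ideal.mem_comap, iterateFrobenius_def]
    · exact Ideal.subset_span (Or.inl (by rw [← pow_mul, mul_comm]))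
    · exact Ideal.pow_mem_of_mem _ (Ideal.subset_span (by simp)) _ hp
    · exact Ideal.subset_span (Or.inr (Or.inr (by rw [← pow_mul, mul_comm]; rfl)))
  · obtain ⟨n, a, rfl⟩ := hw.exists_smul_eq e he
    exact ⟨n, a, rfl⟩

theorem exists_mem_frobeniusMaps_notMem_socleVanishing (hw : IsInverseMonomialSequence x y z w)
    (hxy : x * y = 0) (t : ℕ) :
    ∃ φ ∈ frobeniusMaps p S E t, φ ∉ socleVanishing E p x z t := by
  obtain ⟨F, hF⟩ := hw.exists_semilinearMap_apply (p := p) t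
  let mulX : E →ₗ[S] Submodule.torsionBy S E y := (LinearMap.lsmul S E x).codRestrict _ fun e => by
    rw [Submodule.mem_torsionBy_iff, LinearMap.lsmul_apply, ← mul_smul, mul_comm, hxy, zero_smul]
  refine ⟨(F ∘ₛₗ mulX).toAddMonoidHom, (F ∘ₛₗ mulX).map_smulₛₗ, fun h => hw.ne_zero ?_⟩
  have hxu : x • z • w 1 = w 0 := by rw [← mul_smul, hw.smul_succ]
  have hkill (n) (a : S) (ha : a ∈ ({x ^ (n + 1), y, z ^ (n + 1)} : Set S)) : a • w n = 0 :=
    (hw.smul_eq_zero_iff n a).mpr (Ideal.subset_span ha)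
  have hzero := h (z • w 1) (by rw [← mul_smul, ← sq, hkill 1 _ (by simp)])
    (by rw [hxu]; simpa using hkill 0 x (by simp))
  have happly : F (mulX (z • w 1)) = w (p ^ t - 1) := by
    rw [show mulX (z • w 1) = ⟨w 0, hw.smul_eq_zero 0⟩ from Subtype.ext hxu, hF, zero_add,
      mul_one]
  rw [← hw.pow_sub_smul (Nat.zero_le (p ^ t - 1)), ← happly]
  exact hzero

end IsInverseMonomialSequence

theorem not_finitelyGeneratedOver_ofEnd (hp : p.Prime) (hxy : x * y = 0) (hyz : y * z = 0)
    (hdiv : ∀ v : E, x • v = 0 → y • v = 0 → z • v = 0 → ∃ v', y • v' = v)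
    (hw : IsInverseMonomialSequence x y z w) : ¬ FinitelyGeneratedOver (ofEnd p S E) :=
  (containsDecomposables_socleVanishing hxy hyz hp.one_lt hdiv).not_finitelyGeneratedOver
    (fun _ t ht => DirectSum.of_eq_of_ne (β := (frobeniusMaps p S E ·)) 0 t _ ht.ne')
    fun N => ⟨N + 1, N.lt_succ_self,
      hw.exists_mem_frobeniusMaps_notMem_socleVanishing hxy (N + 1)⟩

end IndecomposableMaps

section Ideals

open MvPowerSeries

/-- The exponent of `x ^ a * y ^ b * z ^ c`. -/
noncomputable def exponent (a b c : ℕ) : Fin 3 →₀ ℕ :=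
  Finsupp.single 0 a + Finsupp.single 1 b + Finsupp.single 2 c

@[simp] theorem exponent_apply_zero (a b c : ℕ) : exponent a b c 0 = a := by simp [exponent]

@[simp] theorem exponent_apply_one (a b c : ℕ) : exponent a b c 1 = b := by simp [exponent]

@[simp] theorem exponent_apply_two (a b c : ℕ) : exponent a b c 2 = c := by simp [exponent]

theorem exponent_le_iff {a b c : ℕ} {d : Fin 3 →₀ ℕ} :
    exponent a b c ≤ d ↔ a ≤ d 0 ∧ b ≤ d 1 ∧ c ≤ d 2 := by
  simp [Finsupp.le_def, Fin.forall_fin_succ]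

variable (K : Type u) [Field K]

theorem monomial_exponent (a b c : ℕ) :
    monomial (exponent a b c) (1 : K) = x K ^ a * y K ^ b * z K ^ c := by
  simp [x, y, z, X_pow_eq, monomial_mul_monomial, exponent]

theorem span_X_pow_exponent (a b c : ℕ) :
    Ideal.span (Set.range fun s => (X s : R K) ^ (exponent a b c s + 1)) =
      Ideal.span {x K ^ (a + 1), y K ^ (b + 1), z K ^ (c + 1)} := by
  congr 1
  ext f
  simp [Fin.exists_fin_succ, x, y, z, eq_comm]

theorem monomial_notMem_span (a b c : ℕ) :
    x K ^ a * y K ^ b * z K ^ c ∉ Ideal.span {x K ^ (a + 1), y K ^ (b + 1), z K ^ (c + 1)} := by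
  rw [← monomial_exponent, ← span_X_pow_exponent]
  exact monomial_notMem_span_X_pow _

variable {K} {p : ℕ}

theorem frobeniusPower_span {A : Type u} [CommRing A] (p : ℕ) [ExpChar A p] (s : Set A) (e : ℕ) :
    frobeniusPower (Ideal.span s) (p ^ e) = Ideal.span ((· ^ p ^ e) '' s) :=
  Ideal.map_span (iterateFrobenius A p e) s

theorem mem_idealK_iff {e : ℕ} {f : R K} :
    f ∈ idealK p (I K) e ↔ x K * y K * f ∈ frobeniusPower (I K) (p ^ e) ∧
      y K * z K * f ∈ frobeniusPower (I K) (p ^ e) := by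
  rw [idealK, I, Ideal.colon_span]
  simp [Submodule.mem_colon, mul_comm]

variable [Fact p.Prime] [CharP K p]

instance charP_R : CharP (R K) p :=
  charP_of_injective_algebraMap (algebraMap K (R K)).injective p

theorem frobeniusPower_I (e : ℕ) :
    frobeniusPower (I K) (p ^ e) =
      Ideal.span {x K ^ p ^ e * y K ^ p ^ e, y K ^ p ^ e * z K ^ p ^ e} := by
  rw [I, frobeniusPower_span, Set.image_pair, mul_pow, mul_pow]

theorem idealK_le_span (e : ℕ) :
    idealK p (I K) e ≤ Ideal.span
      {x K ^ (p ^ e) * y K ^ (p ^ e - 1),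
        x K ^ (p ^ e - 1) * y K ^ (p ^ e - 1) * z K ^ (p ^ e - 1),
        y K ^ (p ^ e - 1) * z K ^ (p ^ e)} := by
  intro f hf
  classical
  rw [mem_idealK_iff, frobeniusPower_I] at hf
  generalize p ^ e = q at hf ⊢
  have hxy : x K * y K = monomial (exponent 1 1 0) 1 := by simp [monomial_exponent]
  have hyz : y K * z K = monomial (exponent 0 1 1) 1 := by simp [monomial_exponent]
  have hI : ({x K ^ q * y K ^ q, y K ^ q * z K ^ q} : Set (R K)) =
      (monomial · 1) '' {exponent q q 0, exponent 0 q q} := by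
    simp [Set.image_pair, monomial_exponent]
  let G : Finset (Fin 3 →₀ ℕ) :=
    {exponent q (q - 1) 0, exponent (q - 1) (q - 1) (q - 1), exponent 0 (q - 1) q}
  have hG : ({x K ^ q * y K ^ (q - 1), x K ^ (q - 1) * y K ^ (q - 1) * z K ^ (q - 1),
      y K ^ (q - 1) * z K ^ q} : Set (R K)) = (monomial · 1) '' G := by
    simp [G, Set.image_insert_eq, monomial_exponent]
  rw [hxy, hyz, hI] at hf
  rw [hG]
  refine mem_span_monomial_of_forall_exists_le fun d hd => ?_
  have hxyd := exists_le_add_of_monomial_mul_mem_span hf.1 hd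
  have hyzd := exists_le_add_of_monomial_mul_mem_span hf.2 hd
  simp only [G, exponent_le_iff, Finset.mem_insert, Finset.mem_singleton,
    Set.mem_insert_iff, Set.mem_singleton_iff, exists_eq_or_imp, exists_eq_left, Finsupp.add_apply,
    exponent_apply_zero, exponent_apply_one, exponent_apply_two] at hxyd hyzd ⊢
  omega

theorem idealK_eq_span (e : ℕ) :
    idealK p (I K) e = Ideal.span
      {x K ^ (p ^ e) * y K ^ (p ^ e - 1),
        x K ^ (p ^ e - 1) * y K ^ (p ^ e - 1) * z K ^ (p ^ e - 1),
        y K ^ (p ^ e - 1) * z K ^ (p ^ e)} := by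
  refine (idealK_le_span e).antisymm (Ideal.span_le.mpr ?_)
  rintro _ (rfl | rfl | rfl) <;>
    rw [SetLike.mem_coe, mem_idealK_iff, frobeniusPower_I, Ideal.mem_span_pair, Ideal.mem_span_pair]
  all_goals
    obtain ⟨n, hn⟩ := Nat.exists_eq_add_of_le' (Nat.one_le_pow e p (Nat.Prime.pos Fact.out))
    rw [hn, Nat.add_sub_cancel]
  · exact ⟨⟨x K, 0, by ring⟩, ⟨z K, 0, by ring⟩⟩
  · exact ⟨⟨z K ^ n, 0, by ring⟩, ⟨0, x K ^ n, by ring⟩⟩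
  · exact ⟨⟨0, x K, by ring⟩, ⟨0, z K, by ring⟩⟩

/-- The ideal `(xⁿ, z)`: modulo `z`, it measures the order in `x` of the factors of `L_e`. -/
noncomputable def spanXPowZ (K : Type u) [Field K] (n : ℕ) : Ideal (R K) :=
  Ideal.span {x K ^ n, z K}

theorem spanXPowZ_antitone : Antitone (spanXPowZ K) := by
  refine fun m n h => Ideal.span_le.mpr ?_
  rintro _ (rfl | rfl)
  · exact Ideal.mem_of_dvd _ (pow_dvd_pow _ h) (Ideal.subset_span (by simp))
  · exact Ideal.subset_span (by simp)

theorem spanXPowZ_mul_le (m n : ℕ) : spanXPowZ K m * spanXPowZ K n ≤ spanXPowZ K (m + n) := by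
  have hz : z K ∈ spanXPowZ K (m + n) := Ideal.subset_span (by simp)
  rw [spanXPowZ, spanXPowZ, Ideal.span_mul_span', Ideal.span_le]
  rintro _ ⟨_, (rfl | rfl), _, (rfl | rfl), rfl⟩
  · exact Ideal.subset_span (Or.inl (pow_add _ _ _).symm)
  · exact Ideal.mul_mem_left _ _ hz
  · exact Ideal.mul_mem_right _ _ hz
  · exact Ideal.mul_mem_right _ _ hz

theorem frobeniusPower_idealK_le {β : ℕ} (hβ : 1 ≤ β) (t : ℕ) :
    frobeniusPower (idealK p (I K) β) (p ^ t) ≤ spanXPowZ K (p ^ (t + β)) := by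
  have hp : p.Prime := Fact.out
  have hq : p ^ β - 1 ≠ 0 := (Nat.sub_pos_of_lt (Nat.one_lt_pow (by omega) hp.one_lt)).ne'
  have ht : p ^ t ≠ 0 := pow_ne_zero _ hp.ne_zero
  rw [idealK_eq_span, frobeniusPower_span, Ideal.span_le]
  rintro _ ⟨a, (rfl | rfl | rfl), rfl⟩
  · refine Ideal.mem_of_dvd _ ?_ (Ideal.subset_span (Set.mem_insert _ _))
    simp only [mul_pow, ← pow_mul, ← pow_add, add_comm β]
    exact dvd_mul_right _ _
  all_goals
    refine Ideal.mem_of_dvd _ ?_ (Ideal.subset_span (Set.mem_insert_of_mem _ rfl))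
  · exact dvd_pow (dvd_mul_of_dvd_right (dvd_pow_self _ hq) _) ht
  · exact dvd_pow (dvd_mul_of_dvd_right (dvd_pow_self _ (pow_ne_zero _ hp.ne_zero)) _) ht

theorem idealL_le_spanXPowZ {e : ℕ} (he : 1 ≤ e) : idealL p (I K) e ≤ spanXPowZ K (p ^ e + 1) := by
  refine iSup_le fun s => iSup_le fun β => iSup_le fun ⟨hβ, hsum⟩ => ?_
  match s, β with
  | 0, β => exact absurd hsum (by simpa using (Nat.pos_iff_ne_zero.mp he).symm)
  | 1, β => exact absurd hsum (by simpa using (hβ 0).2.ne)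
  | n + 2, β =>
    -- the last factor contributes `x ^ p ^ e` and the first one a further factor `x`
    rw [Fin.prod_univ_castSucc, mul_comm]
    refine (Ideal.mul_mono ?_ ?_).trans (spanXPowZ_mul_le (p ^ e) 1)
    · have hlast : ∑ j ∈ Finset.Iio (Fin.last (n + 1)), β j + β (Fin.last (n + 1)) = e := by
        have hIio : Finset.Iio (Fin.last (n + 1)) = Finset.univ.map Fin.castSuccEmb := by
          ext j
          simp [Fin.exists_castSucc_eq]
        rw [← hsum, Fin.sum_univ_castSucc, hIio, Finset.sum_map]
        rfl
      exact hlast ▸ frobeniusPower_idealK_le (hβ _).1 _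
    · refine Ideal.prod_le_inf.trans ((Finset.inf_le (Finset.mem_univ 0)).trans ?_)
      exact (frobeniusPower_idealK_le (hβ _).1 _).trans
        (spanXPowZ_antitone (Nat.one_le_pow _ _ (Nat.Prime.pos Fact.out)))

theorem x_pow_mul_y_pow_notMem_idealL {e : ℕ} (he : 1 ≤ e) :
    x K ^ (p ^ e) * y K ^ (p ^ e - 1) ∉ idealL p (I K) e := fun h => by
  refine monomial_notMem_span K (p ^ e) (p ^ e - 1) 0 ?_
  rw [pow_zero, mul_one, zero_add, pow_one]
  refine (Ideal.span_mono ?_ : spanXPowZ K (p ^ e + 1) ≤ _) (idealL_le_spanXPowZ he h)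
  simp [Set.insert_subset_iff]

end Ideals

section QuotientRing

open IsLocalRing

variable (K : Type u) [Field K]

/-- The class of `x` in `S`. -/
noncomputable abbrev xBar : S K := Ideal.Quotient.mk (I K) (x K)

/-- The class of `y` in `S`. -/
noncomputable abbrev yBar : S K := Ideal.Quotient.mk (I K) (y K)

/-- The class of `z` in `S`. -/
noncomputable abbrev zBar : S K := Ideal.Quotient.mk (I K) (z K)

theorem maximalIdeal_S_eq_span : maximalIdeal (S K) = Ideal.span {xBar K, yBar K, zBar K} := by
  have hX : Set.range MvPowerSeries.X = {x K, y K, z K} := by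
    ext f
    simp [Fin.exists_fin_succ, x, y, z, eq_comm]
  rw [← map_maximalIdeal_of_surjective (Ideal.Quotient.mk (I K)) Ideal.Quotient.mk_surjective,
    maximalIdeal_eq_span_range_X, hX, Ideal.map_span]
  simp only [Set.image_insert_eq, Set.image_singleton]

theorem I_le_span_y : I K ≤ Ideal.span {y K} := by
  rw [I, Ideal.span_le]
  rintro _ (rfl | rfl)
  exacts [Ideal.mem_span_singleton.mpr (dvd_mul_left _ _),
    Ideal.mem_span_singleton.mpr (dvd_mul_right _ _)]

theorem y_notMem_I : y K ∉ I K := fun h => by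
  have hle : I K ≤ Ideal.span {x K ^ (0 + 1), y K ^ (1 + 1), z K ^ (0 + 1)} := by
    rw [I, Ideal.span_le]
    rintro _ (rfl | rfl)
    exacts [Ideal.mul_mem_right _ _ (Ideal.subset_span (by simp)),
      Ideal.mul_mem_left _ _ (Ideal.subset_span (by simp))]
  exact monomial_notMem_span K 0 1 0 (by simpa using hle h)

variable {K}

theorem mk_mem_span_iff {n : ℕ} {f : R K} :
    Ideal.Quotient.mk (I K) f ∈ Ideal.span {xBar K ^ (n + 1), yBar K, zBar K ^ (n + 1)} ↔
      f ∈ Ideal.span {x K ^ (n + 1), y K, z K ^ (n + 1)} := by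
  have hle : I K ≤ Ideal.span {x K ^ (n + 1), y K, z K ^ (n + 1)} :=
    (I_le_span_y K).trans (Ideal.span_mono (by simp))
  rw [← Ideal.mem_quotient_iff_mem hle, Ideal.map_span]
  simp only [Set.image_insert_eq, Set.image_singleton, map_pow]

theorem mk_monomial_exponent (n : ℕ) : Ideal.Quotient.mk (I K)
    (MvPowerSeries.monomial (exponent n 0 n) 1) = (xBar K * zBar K) ^ n := by
  rw [monomial_exponent, pow_zero, mul_one, map_mul, map_pow, map_pow, mul_pow]

theorem xBar_mul_zBar_pow_notMem_span (n : ℕ) :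
    (xBar K * zBar K) ^ n ∉ Ideal.span {xBar K ^ (n + 1), yBar K, zBar K ^ (n + 1)} := by
  rw [← mk_monomial_exponent, mk_mem_span_iff, monomial_exponent]
  simpa using monomial_notMem_span K n 0 n

theorem exists_mul_sub_xBar_mul_zBar_pow_mem_span (n : ℕ) {a : S K}
    (ha : a ∉ Ideal.span {xBar K ^ (n + 1), yBar K, zBar K ^ (n + 1)}) :
    ∃ b, b * a - (xBar K * zBar K) ^ n ∈
      Ideal.span {xBar K ^ (n + 1), yBar K, zBar K ^ (n + 1)} := by
  obtain ⟨f, rfl⟩ := Ideal.Quotient.mk_surjective a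
  have hspan := span_X_pow_exponent K n 0 n
  rw [zero_add, pow_one] at hspan
  rw [mk_mem_span_iff, ← hspan] at ha
  obtain ⟨g, hg⟩ := exists_mul_sub_monomial_mem_span_X_pow _ ha
  rw [hspan, ← mk_mem_span_iff, map_sub, map_mul, mk_monomial_exponent] at hg
  exact ⟨_, hg⟩

instance isPrecomplete_R : IsPrecomplete (maximalIdeal (R K)) (R K) := by
  rw [maximalIdeal_eq_span_range_X]
  infer_instance

instance isPrecomplete_S : IsPrecomplete (maximalIdeal (S K)) (S K) :=
  isPrecomplete_maximalIdeal_quotient (I K)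

theorem IsInjectiveHull.not_finitelyGeneratedOver_ofEnd {p : ℕ} [Fact p.Prime] [CharP K p]
    {E : Type u} [AddCommGroup E] [Module (S K) E] {i : ResidueField (S K) →ₗ[S K] E}
    (hE : IsInjectiveHull i) : ¬ FinitelyGeneratedOver (ofEnd p (S K) E) := by
  have : CharP (S K) p := charP_of_injective_algebraMap (algebraMap K (S K)).injective p
  have hmem {g : S K} (hg : g ∈ ({xBar K, yBar K, zBar K} : Set (S K))) :
      g ∈ maximalIdeal (S K) :=
    maximalIdeal_S_eq_span K ▸ Ideal.subset_span hg
  obtain ⟨w, hw⟩ := hE.exists_isInverseMonomialSequence (hmem (by simp)) (hmem (by simp))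
    (hmem (by simp)) xBar_mul_zBar_pow_notMem_span fun n _ =>
      exists_mul_sub_xBar_mul_zBar_pow_mem_span n
  refine FrobeniusMaps.not_finitelyGeneratedOver_ofEnd Fact.out ?_ ?_ (fun v hx hy hz => ?_) hw
  · exact Ideal.Quotient.eq_zero_iff_mem.mpr (Ideal.subset_span (by simp))
  · exact Ideal.Quotient.eq_zero_iff_mem.mpr (Ideal.subset_span (by simp))
  · have hsocle : maximalIdeal (S K) ≤ LinearMap.ker (LinearMap.toSpanSingleton (S K) E v) := by
      rw [maximalIdeal_S_eq_span, Ideal.span_le]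
      rintro _ (rfl | rfl | rfl)
      exacts [hx, hy, hz]
    exact hE.exists_smul_eq_of_mem_socle (Ideal.Quotient.eq_zero_iff_mem.not.mpr (y_notMem_I K))
      hsocle

end QuotientRing

end FrobeniusMaps

open FrobeniusMaps in
theorem mainTheorem1 {p : ℕ} [Fact p.Prime] {K : Type u} [Field K] [CharP K p]
    {E : Type u} [AddCommGroup E] [Module (S K) E]
    (i : IsLocalRing.ResidueField (S K) →ₗ[S K] E) (hE : IsInjectiveHull i) :
    -- `S → Hom_S(E, E)` is an isomorphism
    Function.Bijective (algebraMap (S K) (Module.End (S K) E)) ∧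
    -- `𝓕(E)` is not finitely generated over `Hom_S(E, E)`
    ¬ FinitelyGeneratedOver (ofEnd p (S K) E) ∧
    -- `x ^ (p ^ e) * y ^ (p ^ e - 1)` is one of the generators of `K_e` and is not in `L_e`
    ∀ e : ℕ, 1 ≤ e →
      idealK p (I K) e = Ideal.span
        {x K ^ (p ^ e) * y K ^ (p ^ e - 1),
          x K ^ (p ^ e - 1) * y K ^ (p ^ e - 1) * z K ^ (p ^ e - 1),
          y K ^ (p ^ e - 1) * z K ^ (p ^ e)} ∧
      x K ^ (p ^ e) * y K ^ (p ^ e - 1) ∉ idealL p (I K) e :=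
  ⟨hE.algebraMap_end_bijective, hE.not_finitelyGeneratedOver_ofEnd,
    fun e he => ⟨idealK_eq_span e, x_pow_mul_y_pow_notMem_idealL he⟩⟩
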